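/- Let $X$ be a complex Banach space with open unit ball $B_X$ and closed unit ball $\overline{B}_X$. Let $\mathcal{H}L_0(B_X)$ be the space of all holomorphic (complex Fréchet differentiable) Lipschitz functions $f\colon B_X\to\mathbb{C}$ with $f(0)=0$, normed by the Lipschitz constant $L(f)=\sup_{x\ne y}\frac{|f(x)-f(y)|}{\|x-y\|}$; it is closed under pointwise products. Every $f\in\mathcal{H}L_0(B_X)$ extends uniquely to a continuous function on $\overline{B}_X$, still denoted by $f$, and for $x\in\overline{B}_X$ we let $\delta(x)\in\mathcal{H}L_0(B_X)^*$ be the evaluation functional $f\mapsto f(x)$. Let $\mathcal{G}_0(B_X)$ be the norm-closed linear span of $\{\delta(x):x\in B_X\}$ in $\mathcal{H}L_0(B_X)^*$. Suppose that $X$ has the bounded approximation property: there is $\lambda>0$ such that for every compact $K\subseteq X$ and every $\varepsilon>0$ there is a finite-rank bounded linear operator $T\colon X\to X$ with $\|T\|\le\lambda$ and $\|Tx-x\|<\varepsilon$ for all $x\in K$. Let $\varphi\in\mathcal{G}_0(B_X)$ be multiplicative, that is, $\varphi(fg)=\varphi(f)\varphi(g)$ for all $f,g\in\mathcal{H}L_0(B_X)$.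 Then there is a point $x_0\in\overline{B}_X$ such that $\varphi=\delta(x_0)$. -/

import Mathlib

open Metric Filter Topology
open scoped NNReal

noncomputable section

section BAP

variable (X : Type*) [NormedAddCommGroup X] [NormedSpace ℂ X]

/-- The bounded approximation property: for some `lam > 0`, the identity of `X` can be approximated,
uniformly on compact sets, by finite-rank bounded operators of norm at most `lam`. -/
def HasBAP : Prop :=
  ∃ lam : ℝ, 0 < lam ∧ ∀ K : Set X, IsCompact K → ∀ ε : ℝ, 0 < ε →
    ∃ T : X →L[ℂ] X, FiniteDimensional ℂ T.range ∧ ‖T‖ ≤ lam ∧ ∀ x ∈ K, ‖T x - x‖ < ε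

end BAP

section HL

variable (X : Type*) [NormedAddCommGroup X] [NormedSpace ℂ X]

/-- The open unit ball `B_X`, as a type. -/
abbrev UBall : Type _ := ↥(ball (0 : X) 1)

/-- The origin as a point of the open unit ball. -/
def UBall.origin : UBall X := ⟨0, mem_ball_self one_pos⟩

variable {X}

/-- A function on the open unit ball is holomorphic if it is complex Fréchet differentiable at every
point of the ball (the ball is open, so the values of the extension outside it are irrelevant). -/
def IsHolo (f : UBall X → ℂ) : Prop :=
  DifferentiableOn ℂ (Function.extend ((↑) : UBall X → X) f 0) (ball (0 : X) 1)

/-- `f` satisfies a Lipschitz condition on the open unit ball. -/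
def IsLip (f : UBall X → ℂ) : Prop :=
  ∃ C : ℝ≥0, LipschitzWith C f

set_option linter.unusedSectionVars false in
theorem extend_coe_eq (f : UBall X → ℂ) {x : X} (hx : x ∈ ball (0 : X) 1) :
    Function.extend ((↑) : UBall X → X) f 0 x = f ⟨x, hx⟩ :=
  Subtype.val_injective.extend_apply f 0 ⟨x, hx⟩

theorem IsHolo.zero : IsHolo (0 : UBall X → ℂ) :=
  (differentiableOn_const (0 : ℂ)).congr fun x hx => by rw [extend_coe_eq _ hx]; rfl

theorem IsHolo.add {f g : UBall X → ℂ} (hf : IsHolo f) (hg : IsHolo g) : IsHolo (f + g) :=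
  (DifferentiableOn.add hf hg).congr fun x hx => by
    simp only [Pi.add_apply, extend_coe_eq _ hx]

theorem IsHolo.mul {f g : UBall X → ℂ} (hf : IsHolo f) (hg : IsHolo g) : IsHolo (f * g) :=
  (DifferentiableOn.mul hf hg).congr fun x hx => by
    simp only [Pi.mul_apply, extend_coe_eq _ hx]

theorem IsHolo.smul (c : ℂ) {f : UBall X → ℂ} (hf : IsHolo f) : IsHolo (c • f) :=
  (DifferentiableOn.const_smul hf c).congr fun x hx => by
    simp only [Pi.smul_apply, extend_coe_eq _ hx]

set_option linter.unusedSectionVars false in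
theorem norm_le_of_lipschitz {f : UBall X → ℂ} {C : ℝ≥0} (hf : LipschitzWith C f)
    (h0 : f (UBall.origin X) = 0) (x : UBall X) : ‖f x‖ ≤ C * ‖(x : X)‖ := by
  have h := hf.dist_le_mul x (UBall.origin X)
  rwa [h0, dist_zero_right, Subtype.dist_eq, UBall.origin, dist_zero_right] at h

theorem IsLip.mul {f g : UBall X → ℂ} (hf : IsLip f) (hg : IsLip g)
    (hf0 : f (UBall.origin X) = 0) (hg0 : g (UBall.origin X) = 0) : IsLip (f * g) := by
  obtain ⟨C, hC⟩ := hf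
  obtain ⟨D, hD⟩ := hg
  refine ⟨2 * C * D, LipschitzWith.of_dist_le_mul fun x y => ?_⟩
  have hx : ‖(x : X)‖ ≤ 1 := (mem_ball_zero_iff.1 x.2).le
  have hy : ‖(y : X)‖ ≤ 1 := (mem_ball_zero_iff.1 y.2).le
  have h1 := hC.dist_le_mul x y
  have h2 := hD.dist_le_mul x y
  have h3 : ‖f y‖ ≤ C := (norm_le_of_lipschitz hC hf0 y).trans
    (mul_le_of_le_one_right C.2 hy)
  have h4 : ‖g x‖ ≤ D := (norm_le_of_lipschitz hD hg0 x).trans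
    (mul_le_of_le_one_right D.2 hx)
  rw [dist_eq_norm] at h1 h2 ⊢
  have e : (f * g) x - (f * g) y = (f x - f y) * g x + f y * (g x - g y) := by
    simp only [Pi.mul_apply]; ring
  rw [e]
  calc _ ≤ ‖f x - f y‖ * ‖g x‖ + ‖f y‖ * ‖g x - g y‖ := by
        refine (norm_add_le _ _).trans_eq ?_
        rw [norm_mul, norm_mul]
    _ ≤ (C * dist x y) * D + C * (D * dist x y) := by gcongr
    _ = _ := by push_cast; ring

variable (X)

/-- The holomorphic Lipschitz functions on `B_X` vanishing at `0`, as a (non-unital) algebra under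
the pointwise operations. -/
def holLipAlgebra : NonUnitalSubalgebra ℂ (UBall X → ℂ) where
  carrier := {f | IsHolo f ∧ IsLip f ∧ f (UBall.origin X) = 0}
  zero_mem' := ⟨IsHolo.zero, ⟨0, LipschitzWith.const 0⟩, rfl⟩
  add_mem' := by
    rintro f g ⟨hf, ⟨C, hC⟩, hf0⟩ ⟨hg, ⟨D, hD⟩, hg0⟩
    exact ⟨hf.add hg, ⟨C + D, hC.add hD⟩, by simp [hf0, hg0]⟩
  mul_mem' := by
    rintro f g ⟨hf, hf', hf0⟩ ⟨hg, hg', hg0⟩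
    exact ⟨hf.mul hg, hf'.mul hg' hf0 hg0, by simp [hf0]⟩
  smul_mem' := by
    rintro c f ⟨hf, ⟨C, hC⟩, hf0⟩
    refine ⟨hf.smul c, ⟨‖c‖₊ * C, LipschitzWith.of_dist_le_mul fun x y => ?_⟩, by simp [hf0]⟩
    have h := hC.dist_le_mul x y
    rw [Pi.smul_apply, Pi.smul_apply, dist_smul₀]
    push_cast
    rw [mul_assoc]
    gcongr

/-- The space `𝓗L₀(B_X)` of holomorphic Lipschitz functions on the open unit ball that vanish at `0`.
It is a type of its own, so that its only topology is that of the norm defined below. -/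
def HL0 : Type _ := ↥(holLipAlgebra X)

instance : NonUnitalCommRing (HL0 X) := inferInstanceAs (NonUnitalCommRing ↥(holLipAlgebra X))

instance : Module ℂ (HL0 X) := inferInstanceAs (Module ℂ ↥(holLipAlgebra X))

instance : FunLike (HL0 X) (UBall X) ℂ where
  coe f := f.1
  coe_injective := Subtype.val_injective

variable {X}

namespace HL0

theorem add_apply (f g : HL0 X) (x : UBall X) : (f + g) x = f x + g x := rfl

theorem mul_apply (f g : HL0 X) (x : UBall X) : (f * g) x = f x * g x := rfl

theorem smul_apply (c : ℂ) (f : HL0 X) (x : UBall X) : (c • f) x = c * f x := rfl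

theorem neg_apply (f : HL0 X) (x : UBall X) : (-f) x = -f x := rfl

theorem isHolo (f : HL0 X) : IsHolo (f : UBall X → ℂ) := f.2.1

theorem isLip (f : HL0 X) : IsLip (f : UBall X → ℂ) := f.2.2.1

theorem map_origin (f : HL0 X) : f (UBall.origin X) = 0 := f.2.2.2

/-- The Lipschitz constant `L(f) = sup_{x ≠ y} |f x - f y| / ‖x - y‖` (the pairs with `x = y`
contribute the value `0`). -/
def lipConst (f : HL0 X) : ℝ :=
  ⨆ p : UBall X × UBall X, ‖f p.1 - f p.2‖ / ‖(p.1 : X) - (p.2 : X)‖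

theorem bddAbove_quot (f : HL0 X) : BddAbove (Set.range fun p : UBall X × UBall X =>
    ‖f p.1 - f p.2‖ / ‖(p.1 : X) - (p.2 : X)‖) := by
  obtain ⟨C, hC⟩ := f.isLip
  refine ⟨C, ?_⟩
  rintro _ ⟨p, rfl⟩
  refine div_le_of_le_mul₀ (norm_nonneg _) C.2 ?_
  have h := hC.dist_le_mul p.1 p.2
  rwa [dist_eq_norm, Subtype.dist_eq, dist_eq_norm] at h

theorem lipConst_nonneg (f : HL0 X) : 0 ≤ lipConst f :=
  Real.iSup_nonneg fun _ => by positivity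

theorem norm_sub_le_lipConst (f : HL0 X) (x y : UBall X) :
    ‖f x - f y‖ ≤ lipConst f * ‖(x : X) - (y : X)‖ := by
  rcases eq_or_ne x y with rfl | hxy
  · simp
  · have hpos : 0 < ‖(x : X) - (y : X)‖ :=
      norm_pos_iff.2 (sub_ne_zero.2 fun h => hxy (Subtype.ext h))
    exact (div_le_iff₀ hpos).1 (le_ciSup f.bddAbove_quot (x, y))

theorem lipConst_le {f : HL0 X} {C : ℝ} (hC : 0 ≤ C)
    (h : ∀ x y : UBall X, ‖f x - f y‖ ≤ C * ‖(x : X) - (y : X)‖) : lipConst f ≤ C :=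
  Real.iSup_le (fun p => div_le_of_le_mul₀ (norm_nonneg _) hC (h p.1 p.2)) hC

theorem norm_apply_le_lipConst (f : HL0 X) (x : UBall X) :
    ‖f x‖ ≤ lipConst f * ‖(x : X)‖ := by
  have h := f.norm_sub_le_lipConst x (UBall.origin X)
  rw [f.map_origin, sub_zero] at h
  simpa [UBall.origin] using h

theorem lipConst_smul_le (c : ℂ) (f : HL0 X) : lipConst (c • f) ≤ ‖c‖ * lipConst f :=
  lipConst_le (mul_nonneg (norm_nonneg c) f.lipConst_nonneg) fun x y => by
    rw [smul_apply, smul_apply, ← mul_sub, norm_mul, mul_assoc]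
    exact mul_le_mul_of_nonneg_left (f.norm_sub_le_lipConst x y) (norm_nonneg c)

/-- `L(·)` is a norm on `𝓗L₀(B_X)`. -/
def lipNorm : AddGroupNorm (HL0 X) where
  toFun := lipConst
  map_zero' := le_antisymm
    (lipConst_le le_rfl fun x y => by
      change ‖(0 : ℂ) - 0‖ ≤ _
      simp) (lipConst_nonneg 0)
  add_le' f g := lipConst_le (add_nonneg f.lipConst_nonneg g.lipConst_nonneg) fun x y => by
    rw [add_apply, add_apply, add_sub_add_comm, add_mul]
    exact (norm_add_le _ _).trans
      (add_le_add (f.norm_sub_le_lipConst x y) (g.norm_sub_le_lipConst x y))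
  neg' f := by
    unfold lipConst
    congr 1
    funext p
    rw [neg_apply, neg_apply, ← neg_sub', norm_neg]
  eq_zero_of_map_eq_zero' f hf := DFunLike.ext _ _ fun x => by
    have h := f.norm_apply_le_lipConst x
    rw [show lipConst f = 0 from hf, zero_mul] at h
    exact norm_le_zero_iff.1 h

instance : NormedAddCommGroup (HL0 X) := lipNorm.toNormedAddCommGroup

theorem norm_def (f : HL0 X) : ‖f‖ = lipConst f := rfl

instance : NormedSpace ℂ (HL0 X) where
  norm_smul_le := lipConst_smul_le

/-- The value at `x` of the continuous extension of `f` from `B_X` to the closed unit ball, that is,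
the limit of `f y` as `y → x` with `y ∈ B_X`. -/
def extend (f : HL0 X) (x : ↥(closedBall (0 : X) 1)) : ℂ :=
  limUnder (comap ((↑) : UBall X → X) (𝓝 (x : X))) f

theorem comap_neBot (x : ↥(closedBall (0 : X) 1)) :
    (comap ((↑) : UBall X → X) (𝓝 (x : X))).NeBot := by
  have hx : (x : X) ∈ closure (ball (0 : X) 1) := by
    rw [closure_ball (0 : X) one_ne_zero]; exact x.2
  exact mem_closure_iff_comap_neBot.1 hx

/-- The limit that defines `extend` exists. -/
theorem tendsto_extend (f : HL0 X) (x : ↥(closedBall (0 : X) 1)) :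
    Tendsto f (comap ((↑) : UBall X → X) (𝓝 (x : X))) (𝓝 (f.extend x)) := by
  obtain ⟨C, hC⟩ := f.isLip
  have := comap_neBot x
  have hc : Cauchy (comap ((↑) : UBall X → X) (𝓝 (x : X))) :=
    cauchy_nhds.comap le_rfl
  exact (hc.map hC.uniformContinuous).le_nhds_lim

theorem norm_extend_le (f : HL0 X) (x : ↥(closedBall (0 : X) 1)) :
    ‖f.extend x‖ ≤ ‖(x : X)‖ * ‖f‖ := by
  have := comap_neBot x
  have h : Tendsto (fun y : UBall X => ‖f‖ * ‖(y : X)‖)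
      (comap ((↑) : UBall X → X) (𝓝 (x : X))) (𝓝 (‖f‖ * ‖(x : X)‖)) :=
    (tendsto_comap.norm).const_mul _
  rw [mul_comm]
  exact le_of_tendsto_of_tendsto' (f.tendsto_extend x).norm h f.norm_apply_le_lipConst

variable (X) in
/-- The evaluation functional `δ(x) : f ↦ f x`, for `x` in the open unit ball. -/
def delta (x : UBall X) : StrongDual ℂ (HL0 X) :=
  LinearMap.mkContinuous
    { toFun := fun f => f x
      map_add' := fun _ _ => rfl
      map_smul' := fun _ _ => rfl } ‖(x : X)‖
    fun f => (f.norm_apply_le_lipConst x).trans_eq (mul_comm _ _)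

variable (X) in
/-- The evaluation functional `δ(x) : f ↦ f x`, for `x` in the closed unit ball, where `f` stands
also for its continuous extension to the closed unit ball. -/
def deltaBar (x : ↥(closedBall (0 : X) 1)) : StrongDual ℂ (HL0 X) :=
  LinearMap.mkContinuous
    { toFun := fun f => f.extend x
      map_add' := fun f g => by
        have := comap_neBot x
        exact tendsto_nhds_unique ((f + g).tendsto_extend x)
          ((f.tendsto_extend x).add (g.tendsto_extend x))
      map_smul' := fun c f => by
        have := comap_neBot x
        exact tendsto_nhds_unique ((c • f).tendsto_extend x)
          ((f.tendsto_extend x).const_mul c) } ‖(x : X)‖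
    fun f => f.norm_extend_le x

/-- On the open unit ball the two evaluation functionals agree. -/
theorem deltaBar_eq_delta (x : UBall X) :
    deltaBar X ⟨x, ball_subset_closedBall x.2⟩ = delta X x := by
  ext f
  obtain ⟨C, hC⟩ := f.isLip
  have h := f.tendsto_extend ⟨x, ball_subset_closedBall x.2⟩
  have := comap_neBot (X := X) ⟨x, ball_subset_closedBall x.2⟩
  rw [← nhds_induced] at h
  exact tendsto_nhds_unique h hC.continuous.continuousAt

end HL0

variable (X)

/-- The holomorphic Lipschitz-free space `𝓖₀(B_X)`: the norm-closed linear span in `𝓗L₀(B_X)*` of the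
evaluations at the points of the open unit ball. -/
def G0 : Submodule ℂ (StrongDual ℂ (HL0 X)) :=
  (Submodule.span ℂ (Set.range (HL0.delta X))).topologicalClosure

variable {X}

/-- A functional on `𝓗L₀(B_X)` is multiplicative if it respects the pointwise product. -/
def IsMultiplicative (φ : StrongDual ℂ (HL0 X)) : Prop :=
  ∀ f g : HL0 X, φ (f * g) = φ f * φ g

end HL

end

/-! Restricted to the continuous linear functionals, `δ(x)` is evaluation at `x`. The image of `X`
in its bidual is closed because `X` is complete, so every `φ` in `G0 X` acts on functionals as
evaluation at some `x₀` in `X` (`exists_point_of_mem_G0`). Powers of a norming functional then force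
`‖x₀‖ ≤ 1` (`norm_point_le_one`). It remains to pass from functionals to arbitrary `f`.

If `P` is entire of polynomial growth and `T` has finite rank, `P ∘ T` is a polynomial in finitely
many functionals, so multiplicativity gives the value `P (T x₀)` (`HasValueAt.comp_finiteRank`).
Elements of `G0 X` are continuous for pointwise convergence on norm-bounded sets
(`exists_finset_of_mem_G0`). The bounded approximation property lets `T` tend to the identity with
`P ∘ T` bounded in norm, which gives `φ P = P x₀` (`apply_eq_of_growth`). This applies to the Taylor
terms of `f`; summing them gives `f (r x₀)` as the value at the dilation `x ↦ f (r x)`, `|r| < 1`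
(`apply_dilate`), and `r → 1` concludes. -/

/-! ### Taylor terms of a holomorphic Lipschitz function -/

noncomputable section TaylorTerm

open scoped Nat

variable {X : Type*} [NormedAddCommGroup X] [NormedSpace ℂ X]

/-- The `n`-th term of the Taylor series at `0` of a holomorphic function `F`, as a function on the
whole space. -/
def taylorTerm (F : X → ℂ) (n : ℕ) (x : X) : ℂ :=
  (n ! : ℂ)⁻¹ * iteratedDeriv n (fun ζ : ℂ => F (ζ • x)) 0

theorem smul_mem_unitBall {ρ : ℝ} {x : X} (hx : ρ * ‖x‖ < 1) {ζ : ℂ} (hζ : ‖ζ‖ ≤ ρ) :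
    ζ • x ∈ ball (0 : X) 1 := by
  rw [mem_ball_zero_iff, norm_smul]
  exact (mul_le_mul_of_nonneg_right hζ (norm_nonneg x)).trans_lt hx

theorem differentiableOn_slice {F : X → ℂ} (hF : DifferentiableOn ℂ F (ball 0 1)) {ρ : ℝ} {x : X}
    (hx : ρ * ‖x‖ < 1) : DifferentiableOn ℂ (fun ζ : ℂ => F (ζ • x)) (closedBall 0 ρ) :=
  hF.comp (by fun_prop) fun _ hζ => smul_mem_unitBall hx (mem_closedBall_zero_iff.1 hζ)

theorem exists_radius {E : Type*} [NormedAddCommGroup E] (r : ℝ) :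
    ∃ ρ : ℝ, 0 < ρ ∧ ∀ x : E, ‖x‖ ≤ r → ρ * ‖x‖ < 1 := by
  refine ⟨(|r| + 1)⁻¹, by positivity, fun x hx => ?_⟩
  rw [inv_mul_lt_iff₀ (by positivity)]
  have := le_abs_self r
  linarith

theorem contDiffAt_slice {F : X → ℂ} (hF : DifferentiableOn ℂ F (ball 0 1)) (x : X)
    (n : WithTop ℕ∞) : ContDiffAt ℂ n (fun ζ : ℂ => F (ζ • x)) 0 := by
  obtain ⟨ρ, hρ, h⟩ := exists_radius (E := X) ‖x‖
  exact ((differentiableOn_slice hF (h x le_rfl)).analyticAt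
    (closedBall_mem_nhds 0 hρ)).contDiffAt

theorem taylorTerm_zero_right {F : X → ℂ} (h0 : F 0 = 0) (n : ℕ) : taylorTerm F n 0 = 0 := by
  simp [taylorTerm, h0]

/-- Cauchy's estimate for the difference of the slices through `x` and `y`, which is at most `C ρ ‖x
- y‖` on the circle of radius `ρ`. The radius stays free: depending on `x` it gives polynomial
growth, fixed below 1 it gives Lipschitz bounds on the unit ball. -/
theorem norm_taylorTerm_sub_le {F : X → ℂ} (hF : DifferentiableOn ℂ F (ball 0 1)) {C : ℝ≥0}
    (hC : LipschitzOnWith C F (ball 0 1)) (n : ℕ) {ρ : ℝ} (hρ : 0 < ρ) {x y : X}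
    (hx : ρ * ‖x‖ < 1) (hy : ρ * ‖y‖ < 1) :
    ‖taylorTerm F n x - taylorTerm F n y‖ ≤ C * (ρ * ‖x - y‖) / ρ ^ n := by
  have hd : DiffContOnCl ℂ ((fun ζ : ℂ => F (ζ • x)) - fun ζ : ℂ => F (ζ • y)) (ball 0 ρ) :=
    DifferentiableOn.diffContOnCl (((differentiableOn_slice hF hx).sub
      (differentiableOn_slice hF hy)).mono closure_ball_subset_closedBall)
  have h := Complex.norm_iteratedDeriv_le_of_forall_mem_sphere_norm_le (C := C * (ρ * ‖x - y‖)) n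
    hρ hd fun ζ hζ => by
      have hζ' : ‖ζ‖ = ρ := mem_sphere_zero_iff_norm.1 hζ
      have := hC.dist_le_mul _ (smul_mem_unitBall hx hζ'.le) _ (smul_mem_unitBall hy hζ'.le)
      rwa [dist_eq_norm, dist_eq_norm, ← smul_sub, norm_smul, hζ'] at this
  rw [iteratedDeriv_sub (contDiffAt_slice hF x n) (contDiffAt_slice hF y n)] at h
  rw [taylorTerm, taylorTerm, ← mul_sub, norm_mul, norm_inv, Complex.norm_natCast,
    inv_mul_le_iff₀ (by positivity), ← mul_div_assoc]
  exact h

theorem norm_taylorTerm_le {F : X → ℂ} (hF : DifferentiableOn ℂ F (ball 0 1)) {C : ℝ≥0}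
    (hC : LipschitzOnWith C F (ball 0 1)) (h0 : F 0 = 0) (n : ℕ) (x : X) :
    ‖taylorTerm F n x‖ ≤ C * (‖x‖ + 1) ^ n := by
  have hρ : 0 < (‖x‖ + 1)⁻¹ := by positivity
  have h1 : (‖x‖ + 1)⁻¹ * ‖x‖ < 1 := by
    rw [inv_mul_lt_iff₀ (by positivity)]; linarith
  have h := norm_taylorTerm_sub_le hF hC n hρ h1 (y := 0) (by simp)
  rw [taylorTerm_zero_right h0, sub_zero, sub_zero, inv_pow, div_inv_eq_mul] at h
  refine h.trans ?_
  gcongr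
  exact mul_le_of_le_one_right C.2 h1.le

/-- One-variable Taylor expansion of the slice through `x`, evaluated at `r`. Points of the unit
sphere are allowed because `x₀` may lie there. -/
theorem hasSum_taylorTerm {F : X → ℂ} (hF : DifferentiableOn ℂ F (ball 0 1)) {x : X}
    (hx : ‖x‖ ≤ 1) {r : ℂ} (hr : ‖r‖ < 1) :
    HasSum (fun n => r ^ n * taylorTerm F n x) (F (r • x)) := by
  have hd : DifferentiableOn ℂ (fun ζ : ℂ => F (ζ • x)) (ball 0 1) :=
    hF.comp (by fun_prop) fun ζ hζ => by
      rw [mem_ball_zero_iff] at hζ ⊢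
      rw [norm_smul]
      exact mul_lt_one_of_nonneg_of_lt_one_left (norm_nonneg ζ) hζ hx
  have h := Complex.hasSum_taylorSeries_on_ball hd (mem_ball_zero_iff.2 hr)
  simp only [sub_zero, smul_eq_mul] at h
  have e : (fun n => r ^ n * taylorTerm F n x) =
      fun n => (n ! : ℂ)⁻¹ * (r ^ n * iteratedDeriv n (fun ζ : ℂ => F (ζ • x)) 0) := by
    funext n
    rw [taylorTerm]
    ring
  rwa [e]

/-- The derivative of a holomorphic Lipschitz function is locally Lipschitz. -/
theorem norm_fderiv_sub_le {F : X → ℂ} (hF : DifferentiableOn ℂ F (ball 0 1)) {C : ℝ≥0}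
    (hC : LipschitzOnWith C F (ball 0 1)) {s r : ℝ} (hr : 0 < r) (hs : s + r < 1) {x y : X}
    (hx : ‖x‖ ≤ s) (hy : ‖y‖ ≤ s) : ‖fderiv ℂ F x - fderiv ℂ F y‖ ≤ C / r * ‖x - y‖ := by
  have hmem : ∀ z : X, ‖z‖ ≤ s → ∀ h : X, ‖h‖ ≤ r → z + h ∈ ball (0 : X) 1 := fun z hz h hh => by
    rw [mem_ball_zero_iff]
    linarith [norm_add_le z h]
  have hdiff : ∀ z : X, ‖z‖ ≤ s → ∀ h : X, ∀ ζ : ℂ, ‖ζ • h‖ ≤ r →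
      HasDerivAt (fun ζ : ℂ => F (z + ζ • h)) (fderiv ℂ F (z + ζ • h) h) ζ := by
    intro z hz h ζ hζ
    have h1 := (hF.differentiableAt (isOpen_ball.mem_nhds (hmem z hz _ hζ))).hasFDerivAt
    have h2 : HasDerivAt (fun ζ : ℂ => z + ζ • h) h ζ := by
      simpa using ((hasDerivAt_id ζ).smul_const h).const_add z
    exact h1.comp_hasDerivAt ζ h2
  -- Cauchy's estimate at 0 for `ζ ↦ F (x + ζ h) - F (y + ζ h)`, bounded by `C ‖x - y‖` on the unit
  -- circle.
  have key : ∀ h : X, ‖h‖ = r → ‖(fderiv ℂ F x - fderiv ℂ F y) h‖ ≤ C * ‖x - y‖ := by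
    intro h hh
    have hle : ∀ ζ : ℂ, ‖ζ‖ ≤ 1 → ‖ζ • h‖ ≤ r := fun ζ hζ => by
      rw [norm_smul, hh]; exact mul_le_of_le_one_left hr.le hζ
    have hd : DiffContOnCl ℂ (fun ζ : ℂ => F (x + ζ • h) - F (y + ζ • h)) (ball 0 1) := by
      refine DifferentiableOn.diffContOnCl fun ζ hζ => ?_
      have hζ' := hle ζ (mem_closedBall_zero_iff.1 (closure_ball_subset_closedBall hζ))
      exact ((hdiff x hx h ζ hζ').sub (hdiff y hy h ζ hζ')).differentiableAt.differentiableWithinAt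
    have hb := Complex.norm_deriv_le_of_forall_mem_sphere_norm_le (C := C * ‖x - y‖) one_pos hd
      fun ζ hζ => by
        have hζ' := hle ζ (mem_sphere_zero_iff_norm.1 hζ).le
        have := hC.dist_le_mul _ (hmem x hx _ hζ') _ (hmem y hy _ hζ')
        rwa [dist_eq_norm, dist_add_right, dist_eq_norm] at this
    have e := ((hdiff x hx h 0 (by simpa using hr.le)).sub
      (hdiff y hy h 0 (by simpa using hr.le))).deriv
    have e' : deriv (fun ζ : ℂ => F (x + ζ • h) - F (y + ζ • h)) 0 =
        (fderiv ℂ F x - fderiv ℂ F y) h :=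
      e.trans (by simp)
    rwa [e', div_one] at hb
  refine ContinuousLinearMap.opNorm_le_of_unit_norm (𝕜 := ℂ) (by positivity) fun u hu => ?_
  have hn : ‖((r : ℂ) • u : X)‖ = r := by
    rw [norm_smul, hu, mul_one, Complex.norm_real, Real.norm_of_nonneg hr.le]
  have h := key ((r : ℂ) • u) hn
  rw [map_smul, norm_smul, Complex.norm_real, Real.norm_of_nonneg hr.le] at h
  rw [div_mul_eq_mul_div, le_div_iff₀ hr]
  linarith

theorem continuousOn_fderiv_ball {F : X → ℂ} (hF : DifferentiableOn ℂ F (ball 0 1)) {C : ℝ≥0}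
    (hC : LipschitzOnWith C F (ball 0 1)) : ContinuousOn (fderiv ℂ F) (ball 0 1) := by
  intro x hx
  rw [mem_ball_zero_iff] at hx
  obtain ⟨s, hxs, hs⟩ := exists_between hx
  refine ContinuousAt.continuousWithinAt (ContinuousOn.continuousAt (s := ball 0 s) ?_
    (isOpen_ball.mem_nhds (mem_ball_zero_iff.2 hxs)))
  have hl : LipschitzOnWith (Real.toNNReal (C / ((1 - s) / 2))) (fderiv ℂ F) (ball 0 s) := by
    refine LipschitzOnWith.of_dist_le_mul fun y hy z hz => ?_
    have h12 : 0 < (1 - s) / 2 := by linarith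
    rw [Real.coe_toNNReal _ (by positivity), dist_eq_norm, dist_eq_norm]
    exact norm_fderiv_sub_le hF hC h12 (by linarith) (mem_ball_zero_iff.1 hy).le
      (mem_ball_zero_iff.1 hz).le
  exact hl.continuousOn

theorem taylorTerm_eq_circleIntegral {F : X → ℂ} (hF : DifferentiableOn ℂ F (ball 0 1)) (n : ℕ)
    {ρ : ℝ} (hρ : 0 < ρ) {x : X} (hx : ρ * ‖x‖ < 1) :
    taylorTerm F n x =
      (2 * Real.pi * Complex.I)⁻¹ * circleIntegral (fun ζ => 1 / ζ ^ (n + 1) * F (ζ • x)) 0 ρ := by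
  have hd : DiffContOnCl ℂ (fun ζ : ℂ => F (ζ • x)) (ball 0 ρ) :=
    ((differentiableOn_slice hF hx).mono closure_ball_subset_closedBall).diffContOnCl
  have h := hd.circleIntegral_one_div_sub_center_pow_smul hρ n
  simp only [sub_zero, smul_eq_mul] at h
  rw [h, taylorTerm, div_mul_eq_mul_div, mul_div_assoc, inv_mul_cancel_left₀, div_eq_inv_mul]
  exact Complex.two_pi_I_ne_zero

/-- Differentiation under Cauchy's integral. One circle serves all `y` within distance 1 of `x`, and
the Lipschitz constant bounds the derivative of `F`, which dominates the integrand. -/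
theorem differentiable_taylorTerm {F : X → ℂ} (hF : DifferentiableOn ℂ F (ball 0 1)) {C : ℝ≥0}
    (hC : LipschitzOnWith C F (ball 0 1)) (n : ℕ) : Differentiable ℂ (taylorTerm F n) := by
  intro x
  obtain ⟨ρ, hρ, hball⟩ := exists_radius (E := X) (‖x‖ + 1)
  have hball' : ∀ y ∈ ball x 1, ρ * ‖y‖ < 1 := fun y hy => hball y <| by
    rw [mem_ball, dist_eq_norm] at hy
    linarith [norm_le_norm_add_norm_sub x y, norm_sub_rev x y]
  have hnhds : ball x 1 ∈ 𝓝 x := isOpen_ball.mem_nhds (mem_ball_self one_pos)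
  set k : ℝ → ℂ := fun θ => deriv (circleMap 0 ρ) θ * (1 / circleMap 0 ρ θ ^ (n + 1)) with hk
  have hkc : Continuous k := by
    have h0 : ∀ θ, circleMap 0 ρ θ ^ (n + 1) ≠ 0 := fun θ =>
      pow_ne_zero _ (circleMap_ne_center hρ.ne')
    have h1 : Continuous (circleMap 0 ρ) := continuous_circleMap 0 ρ
    simp only [hk, deriv_circleMap]
    exact (h1.mul continuous_const).mul (continuous_const.div (h1.pow _) h0)
  have hmem : ∀ y ∈ ball x 1, ∀ θ, circleMap 0 ρ θ • y ∈ ball (0 : X) 1 := fun y hy θ =>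
    smul_mem_unitBall (hball' y hy) (by simp [abs_of_pos hρ])
  have hFc : ∀ y ∈ ball x 1, Continuous fun θ => k θ * F (circleMap 0 ρ θ • y) := fun y hy =>
    hkc.mul (hF.continuousOn.comp_continuous
      ((continuous_circleMap 0 ρ).smul continuous_const) (hmem y hy))
  have hF'c : Continuous fun θ =>
      (k θ * circleMap 0 ρ θ) • fderiv ℂ F (circleMap 0 ρ θ • x) :=
    (hkc.mul (continuous_circleMap 0 ρ)).smul
      ((continuousOn_fderiv_ball hF hC).comp_continuous
        ((continuous_circleMap 0 ρ).smul continuous_const) (hmem x (mem_ball_self one_pos)))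
  have hd : ∀ y ∈ ball x 1, ∀ θ, HasFDerivAt (fun y => k θ * F (circleMap 0 ρ θ • y))
      ((k θ * circleMap 0 ρ θ) • fderiv ℂ F (circleMap 0 ρ θ • y)) y := by
    intro y hy θ
    have h1 := (hF.differentiableAt (isOpen_ball.mem_nhds (hmem y hy θ))).hasFDerivAt
    have h2 : HasFDerivAt (fun y : X => circleMap 0 ρ θ • y)
        (circleMap 0 ρ θ • ContinuousLinearMap.id ℂ X) y := (hasFDerivAt_id y).const_smul _
    refine ((h1.comp y h2).const_mul (k θ)).congr_fderiv ?_
    ext v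
    simp [mul_assoc]
  have hb : ∀ y ∈ ball x 1, ∀ θ,
      ‖(k θ * circleMap 0 ρ θ) • fderiv ℂ F (circleMap 0 ρ θ • y)‖ ≤
        ‖k θ * circleMap 0 ρ θ‖ * C := by
    intro y hy θ
    rw [norm_smul]
    gcongr
    exact norm_fderiv_le_of_lipschitzOn ℂ (isOpen_ball.mem_nhds (hmem y hy θ)) hC
  have main := intervalIntegral.hasFDerivAt_integral_of_dominated_of_fderiv_le
    (μ := MeasureTheory.volume) (a := 0) (b := 2 * Real.pi) hnhds
    (eventually_of_mem hnhds fun y hy => (hFc y hy).aestronglyMeasurable)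
    ((hFc x (mem_ball_self one_pos)).intervalIntegrable _ _) hF'c.aestronglyMeasurable
    (Eventually.of_forall fun θ _ y hy => hb y hy θ)
    ((Continuous.norm (hkc.mul (continuous_circleMap 0 ρ))).mul_const _ |>.intervalIntegrable _ _)
    (Eventually.of_forall fun θ _ y hy => hd y hy θ)
  refine (main.differentiableAt.const_mul
    (2 * Real.pi * Complex.I)⁻¹).congr_of_eventuallyEq ?_
  filter_upwards [hnhds] with y hy
  rw [taylorTerm_eq_circleIntegral hF n hρ (hball' y hy), circleIntegral]
  simp only [hk, smul_eq_mul, mul_assoc]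

end TaylorTerm

/-! ### Entire functions of polynomial growth in one variable -/

section EntirePolynomialGrowth

open scoped Nat

/-- Cauchy's estimate on circles of radius `R → ∞`: growth of order `n < k` leaves a bound of order
`R⁻¹`. -/
theorem iteratedDeriv_eq_zero_of_growth {g : ℂ → ℂ} (hg : Differentiable ℂ g) {A : ℝ} {n : ℕ}
    (hA : ∀ t, ‖g t‖ ≤ A * (1 + ‖t‖) ^ n) {k : ℕ} (hk : n < k) : iteratedDeriv k g 0 = 0 := by
  have hA0 : 0 ≤ A := by simpa using (norm_nonneg _).trans (hA 0)
  have hle : ∀ R : ℝ, 1 ≤ R → ‖iteratedDeriv k g 0‖ ≤ k ! * (A * 2 ^ n) * R⁻¹ := by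
    intro R hR
    have hR0 : 0 < R := by linarith
    have h := Complex.norm_iteratedDeriv_le_of_forall_mem_sphere_norm_le (C := A * (1 + R) ^ n) k
      hR0 (hg.diffContOnCl (s := ball 0 R)) fun z hz => by
        simpa [mem_sphere_zero_iff_norm.1 hz] using hA z
    refine h.trans ?_
    rw [div_le_iff₀ (by positivity)]
    have h1 : (1 + R) ^ n ≤ 2 ^ n * R ^ n := by
      rw [← mul_pow]
      gcongr
      linarith
    have h2 : R ^ n ≤ R⁻¹ * R ^ k := by
      obtain ⟨m, rfl⟩ := Nat.exists_eq_add_of_lt hk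
      rw [pow_succ, mul_comm, mul_assoc, mul_inv_cancel₀ hR0.ne', mul_one]
      exact pow_le_pow_right₀ hR (Nat.le_add_right n m)
    calc (k ! : ℝ) * (A * (1 + R) ^ n) ≤ k ! * (A * (2 ^ n * R ^ n)) := by gcongr
      _ ≤ k ! * (A * (2 ^ n * (R⁻¹ * R ^ k))) := by gcongr
      _ = _ := by ring
  have hlim : Tendsto (fun R : ℝ => k ! * (A * 2 ^ n) * R⁻¹) atTop (𝓝 0) := by
    simpa using tendsto_inv_atTop_zero.const_mul ((k ! : ℝ) * (A * 2 ^ n))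
  exact norm_le_zero_iff.1 (ge_of_tendsto hlim ((eventually_ge_atTop 1).mono hle))

/-- An entire function of polynomial growth is a polynomial. -/
theorem exists_polynomial_of_growth {g : ℂ → ℂ} (hg : Differentiable ℂ g) {A : ℝ} {n : ℕ}
    (hA : ∀ t, ‖g t‖ ≤ A * (1 + ‖t‖) ^ n) :
    ∃ Q : Polynomial ℂ, Q.degree < (n + 1 : ℕ) ∧ ∀ t, Q.eval t = g t := by
  refine ⟨∑ k ∈ Finset.range (n + 1),
    Polynomial.C ((k ! : ℂ)⁻¹ * iteratedDeriv k g 0) * Polynomial.X ^ k, ?_, fun t => ?_⟩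
  · refine (Polynomial.degree_sum_le _ _).trans_lt ((Finset.sup_lt_iff ?_).2 fun k hk => ?_)
    · exact WithBot.bot_lt_coe _
    · exact (Polynomial.degree_C_mul_X_pow_le _ _).trans_lt
        (by exact_mod_cast Finset.mem_range.1 hk)
  · have h := Complex.hasSum_taylorSeries_of_entire hg 0 t
    rw [h.unique (hasSum_sum_of_ne_finset_zero (s := Finset.range (n + 1)) fun k hk => by
      rw [iteratedDeriv_eq_zero_of_growth hg hA (by simpa using hk)]
      simp), Polynomial.eval_finsetSum]
    refine Finset.sum_congr rfl fun k _ => ?_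
    simp only [Polynomial.eval_mul, Polynomial.eval_C, Polynomial.eval_pow, Polynomial.eval_X,
      sub_zero, smul_eq_mul]
    ring

/-- Lagrange interpolation of an entire function of polynomial growth at `0, 1, …, n`. -/
theorem eq_sum_lagrange_of_growth {g : ℂ → ℂ} (hg : Differentiable ℂ g) {A : ℝ} {n : ℕ}
    (hA : ∀ t, ‖g t‖ ≤ A * (1 + ‖t‖) ^ n) (t : ℂ) :
    g t = ∑ i ∈ Finset.range (n + 1),
      g i * (Lagrange.basis (Finset.range (n + 1)) (fun i : ℕ => (i : ℂ)) i).eval t := by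
  obtain ⟨Q, hQ, hQg⟩ := exists_polynomial_of_growth hg hA
  have h := Lagrange.eq_interpolate (s := Finset.range (n + 1)) (v := fun i : ℕ => (i : ℂ))
    (Nat.cast_injective.injOn) (f := Q) (by simpa using hQ)
  rw [← hQg t]
  conv_lhs => rw [h]
  simp [Lagrange.interpolate_apply, Polynomial.eval_finsetSum, hQg]

end EntirePolynomialGrowth

/-! ### Calculus of multiplicative functionals, with constants adjoined -/

noncomputable section MultiplicativeFunctionals

variable {X : Type*} [NormedAddCommGroup X] [NormedSpace ℂ X]

namespace HL0

/-- The restriction to the unit ball of a function on `X`. -/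
def ofFun (F : X → ℂ) (hF : DifferentiableOn ℂ F (ball 0 1)) (C : ℝ≥0)
    (hC : LipschitzOnWith C F (ball 0 1)) (h0 : F 0 = 0) : HL0 X :=
  ⟨fun x => F x, hF.congr fun _ hx => extend_coe_eq _ hx,
    ⟨C, fun x y => hC x.2 y.2⟩, h0⟩

theorem norm_le_of_lipschitzOn {f : HL0 X} {C : ℝ} (hC : 0 ≤ C)
    (h : ∀ x y : UBall X, ‖f x - f y‖ ≤ C * ‖(x : X) - (y : X)‖) : ‖f‖ ≤ C :=
  lipConst_le hC h

/-- The extension of `f` by zero to the whole space. -/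
def extendZero (f : HL0 X) : X → ℂ := Function.extend ((↑) : UBall X → X) f 0

theorem extendZero_coe (f : HL0 X) (x : UBall X) : f.extendZero x = f x := extend_coe_eq _ x.2

theorem extendZero_zero (f : HL0 X) : f.extendZero 0 = 0 :=
  (f.extendZero_coe (UBall.origin X)).trans f.map_origin

theorem differentiableOn_extendZero (f : HL0 X) : DifferentiableOn ℂ f.extendZero (ball 0 1) := f.isHolo

theorem lipschitzOnWith_extendZero (f : HL0 X) : LipschitzOnWith ‖f‖₊ f.extendZero (ball 0 1) :=
  LipschitzOnWith.of_dist_le_mul fun x hx y hy => by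
    have := f.norm_sub_le_lipConst ⟨x, hx⟩ ⟨y, hy⟩
    rw [← extendZero_coe, ← extendZero_coe] at this
    rwa [dist_eq_norm, dist_eq_norm]

/-- The restriction of continuous linear functionals to the unit ball. -/
def ofDual : StrongDual ℂ X →L[ℂ] HL0 X :=
  LinearMap.mkContinuous
    { toFun := fun l => ofFun l l.differentiable.differentiableOn ‖l‖₊
        l.lipschitz.lipschitzOnWith l.map_zero
      map_add' := fun _ _ => rfl
      map_smul' := fun _ _ => rfl } 1 fun l => by
    rw [one_mul]
    exact norm_le_of_lipschitzOn (norm_nonneg l) fun x y => by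
      change ‖l x - l y‖ ≤ _
      rw [← map_sub]
      exact l.le_opNorm _

theorem ofDual_apply (l : StrongDual ℂ X) (x : UBall X) : ofDual l x = l x := rfl

end HL0

/-- `F` has the value `a` at `φ`, where `φ` is extended to the constants by `φ 1 = 1`. -/
def HasValueAt (φ : StrongDual ℂ (HL0 X)) (F : UBall X → ℂ) (a : ℂ) : Prop :=
  ∃ (c : ℂ) (f : HL0 X), (∀ x, F x = c + f x) ∧ a = c + φ f

namespace HasValueAt

variable {φ : StrongDual ℂ (HL0 X)} {F G : UBall X → ℂ} {a b : ℂ}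

theorem const (φ : StrongDual ℂ (HL0 X)) (c : ℂ) : HasValueAt φ (fun _ => c) c :=
  ⟨c, 0, fun _ => (add_zero c).symm, by simp⟩

theorem ofDual (φ : StrongDual ℂ (HL0 X)) (l : StrongDual ℂ X) :
    HasValueAt φ (fun x => l x) (φ (HL0.ofDual l)) :=
  ⟨0, HL0.ofDual l, fun _ => by rw [zero_add, HL0.ofDual_apply], by rw [zero_add]⟩

theorem add (hF : HasValueAt φ F a) (hG : HasValueAt φ G b) :
    HasValueAt φ (fun x => F x + G x) (a + b) := by
  obtain ⟨c, f, hf, rfl⟩ := hF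
  obtain ⟨d, g, hg, rfl⟩ := hG
  refine ⟨c + d, f + g, fun x => ?_, ?_⟩
  · simp only [hf, hg, HL0.add_apply]; ring
  · rw [map_add]; ring

theorem mul (hφ : IsMultiplicative φ) (hF : HasValueAt φ F a) (hG : HasValueAt φ G b) :
    HasValueAt φ (fun x => F x * G x) (a * b) := by
  obtain ⟨c, f, hf, rfl⟩ := hF
  obtain ⟨d, g, hg, rfl⟩ := hG
  refine ⟨c * d, c • g + d • f + f * g, fun x => ?_, ?_⟩
  · simp only [hf, hg, HL0.add_apply, HL0.add_apply, HL0.smul_apply, HL0.smul_apply, HL0.mul_apply]; ring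
  · rw [map_add, map_add, map_smul, map_smul, hφ, smul_eq_mul, smul_eq_mul]; ring

theorem pow (hφ : IsMultiplicative φ) (hF : HasValueAt φ F a) (n : ℕ) :
    HasValueAt φ (fun x => F x ^ n) (a ^ n) := by
  induction n with
  | zero => simpa using const φ 1
  | succ n ih => simpa only [pow_succ] using ih.mul hφ hF

theorem sum {ι : Type*} (s : Finset ι) {F : ι → UBall X → ℂ} {a : ι → ℂ}
    (h : ∀ i ∈ s, HasValueAt φ (F i) (a i)) :
    HasValueAt φ (fun x => ∑ i ∈ s, F i x) (∑ i ∈ s, a i) := by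
  classical
  induction s using Finset.induction_on with
  | empty => simpa using const φ 0
  | insert i s hi ih =>
    simp only [Finset.sum_insert hi]
    exact (h i (Finset.mem_insert_self i s)).add
      (ih fun j hj => h j (Finset.mem_insert_of_mem hj))

theorem polynomial_eval (hφ : IsMultiplicative φ) (hF : HasValueAt φ F a) (Q : Polynomial ℂ) :
    HasValueAt φ (fun x => Q.eval (F x)) (Q.eval a) := by
  simp only [Polynomial.eval_eq_sum, Polynomial.sum]
  exact sum _ fun n _ => (const φ _).mul hφ (hF.pow hφ n)

/-- Elements of `HL0 X` vanish at the origin, so the constant part is the value of `F` there. -/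
theorem exists_of_map_origin (hF : HasValueAt φ F a) (h0 : F (UBall.origin X) = 0) :
    ∃ f : HL0 X, (∀ x, f x = F x) ∧ φ f = a := by
  obtain ⟨c, f, hf, rfl⟩ := hF
  have hc : c = 0 := by simpa [h0, f.map_origin] using (hf (UBall.origin X)).symm
  exact ⟨f, fun x => by rw [hf, hc, zero_add], by rw [hc, zero_add]⟩

/-- A multiplicative functional evaluates functions of finitely many linear functionals that are
polynomial along complex lines. -/
theorem comp_sum_smul (hφ : IsMultiplicative φ) {E : Type*} [NormedAddCommGroup E]
    [NormedSpace ℂ E] {P : E → ℂ} (hP : Differentiable ℂ P) {A : ℝ} {n : ℕ}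
    (hA : ∀ v, ‖P v‖ ≤ A * (1 + ‖v‖) ^ n) {ι : Type*} (s : Finset ι) (e : ι → E)
    {l : ι → UBall X → ℂ} {a : ι → ℂ} (hl : ∀ i, HasValueAt φ (l i) (a i)) (v : E) :
    HasValueAt φ (fun x => P (v + ∑ i ∈ s, l i x • e i)) (P (v + ∑ i ∈ s, a i • e i)) := by
  classical
  induction s using Finset.induction_on generalizing v with
  | empty => simpa using const φ (P v)
  | insert i s hi ih =>
    have hA0 : 0 ≤ A := by simpa using (norm_nonneg _).trans (hA 0)
    -- Along the direction `e i`, `P` is a polynomial of degree at most `n`. Interpolation at `0, …,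
    -- n` separates `t` from `w`: the basis polynomials depend on `t` alone, and the coefficients
    -- fall under the induction hypothesis with base point `v + j • e i`.
    have key : ∀ (w : E) (t : ℂ), P (v + (t • e i + w)) = ∑ j ∈ Finset.range (n + 1),
        P (v + (j : ℂ) • e i + w) *
          (Lagrange.basis (Finset.range (n + 1)) (fun i : ℕ => (i : ℂ)) j).eval t := by
      intro w t
      have hd : Differentiable ℂ fun t : ℂ => P (v + t • e i + w) :=
        hP.comp (by fun_prop)
      rw [← add_assoc]
      refine eq_sum_lagrange_of_growth hd
        (A := A * (1 + ‖v‖ + ‖e i‖ + ‖w‖) ^ n) (fun t => (hA _).trans ?_) t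
      rw [mul_assoc, ← mul_pow]
      have h1 : ‖v + t • e i + w‖ ≤ ‖v‖ + ‖t‖ * ‖e i‖ + ‖w‖ := by
        rw [← norm_smul]; exact norm_add₃_le
      gcongr
      nlinarith [norm_nonneg v, norm_nonneg t, norm_nonneg (e i), norm_nonneg w,
        mul_nonneg (norm_nonneg t) (norm_nonneg v), mul_nonneg (norm_nonneg t) (norm_nonneg w)]
    simp only [Finset.sum_insert hi, key]
    exact sum _ fun j _ => (ih _).mul hφ ((hl i).polynomial_eval hφ _)

end HasValueAt

end MultiplicativeFunctionals

/-! ### Continuity of elements of `G0 X` and the point `x₀` -/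

noncomputable section PreservesLimits

variable {X : Type*} [NormedAddCommGroup X] [NormedSpace ℂ X]

theorem exists_finset_bound_of_mem_span {ψ : StrongDual ℂ (HL0 X)}
    (hψ : ψ ∈ Submodule.span ℂ (Set.range (HL0.delta X))) :
    ∃ (K : Finset (UBall X)) (C : ℝ), 0 ≤ C ∧
      ∀ (g : HL0 X) (δ : ℝ), 0 ≤ δ → (∀ x ∈ K, ‖g x‖ ≤ δ) → ‖ψ g‖ ≤ C * δ := by
  classical
  induction hψ using Submodule.span_induction with
  | mem ψ h =>
    obtain ⟨x, rfl⟩ := h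
    refine ⟨{x}, 1, zero_le_one, fun g δ _ h => ?_⟩
    rw [one_mul]
    exact h x (Finset.mem_singleton_self x)
  | zero => exact ⟨∅, 0, le_rfl, fun g δ _ _ => by simp⟩
  | add ψ₁ ψ₂ _ _ h₁ h₂ =>
    obtain ⟨K₁, C₁, hC₁, h₁⟩ := h₁
    obtain ⟨K₂, C₂, hC₂, h₂⟩ := h₂
    refine ⟨K₁ ∪ K₂, C₁ + C₂, add_nonneg hC₁ hC₂, fun g δ hδ h => ?_⟩
    rw [add_mul]
    exact (norm_add_le _ _).trans (add_le_add
      (h₁ g δ hδ fun x hx => h x (Finset.mem_union_left _ hx))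
      (h₂ g δ hδ fun x hx => h x (Finset.mem_union_right _ hx)))
  | smul c ψ _ h =>
    obtain ⟨K, C, hC, h⟩ := h
    refine ⟨K, ‖c‖ * C, by positivity, fun g δ hδ hg => ?_⟩
    rw [smul_apply, norm_smul, mul_assoc]
    exact mul_le_mul_of_nonneg_left (h g δ hδ hg) (norm_nonneg c)

/-- On bounded sets the elements of `G0 X` are continuous for pointwise convergence. -/
theorem exists_finset_of_mem_G0 {φ : StrongDual ℂ (HL0 X)} (hφ : φ ∈ G0 X) {M ε : ℝ}
    (hM : 0 ≤ M) (hε : 0 < ε) :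
    ∃ (K : Finset (UBall X)) (δ : ℝ), 0 < δ ∧
      ∀ g : HL0 X, ‖g‖ ≤ M → (∀ x ∈ K, ‖g x‖ ≤ δ) → ‖φ g‖ < ε := by
  -- The `+ 1` here and in the choice of `δ` keeps both halves strictly below `ε / 2` and the
  -- denominators nonzero, even if `M` or `C` is 0.
  have hη : 0 < ε / (2 * (M + 1)) := by positivity
  obtain ⟨ψ, hψ, hd⟩ := Metric.mem_closure_iff.1 hφ _ hη
  obtain ⟨K, C, hC, h⟩ := exists_finset_bound_of_mem_span hψ
  refine ⟨K, ε / (2 * (C + 1)), by positivity, fun g hg hK => ?_⟩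
  have h1 : ‖(φ - ψ) g‖ ≤ ε / (2 * (M + 1)) * M := by
    rw [dist_eq_norm] at hd
    exact ((φ - ψ).le_opNorm g).trans (by gcongr)
  have h2 := h g _ (by positivity) hK
  have h3 : ε / (2 * (M + 1)) * M < ε / 2 := by
    rw [div_mul_eq_mul_div, div_lt_div_iff₀ (by positivity) two_pos]
    nlinarith
  have h4 : C * (ε / (2 * (C + 1))) < ε / 2 := by
    rw [← mul_div_assoc, div_lt_div_iff₀ (by positivity) two_pos]
    nlinarith
  have h5 : φ g = (φ - ψ) g + ψ g := by simp
  rw [h5]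
  linarith [norm_add_le ((φ - ψ) g) (ψ g)]

/-- Lets `φ` pass to norm-bounded pointwise limits; needed for Taylor sums and for dilations, where
norm convergence is not required. -/
theorem tendsto_apply_of_mem_G0 {φ : StrongDual ℂ (HL0 X)} (hφ : φ ∈ G0 X) {ι : Type*}
    {u : Filter ι} {f : ι → HL0 X} {g : HL0 X} {M : ℝ} (hM : ∀ᶠ i in u, ‖f i‖ ≤ M)
    (h : ∀ x, Tendsto (fun i => f i x) u (𝓝 (g x))) :
    Tendsto (fun i => φ (f i)) u (𝓝 (φ g)) := by
  rw [Metric.tendsto_nhds]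
  intro ε hε
  obtain ⟨K, δ, hδ, hK⟩ := exists_finset_of_mem_G0 hφ (M := |M| + ‖g‖) (by positivity) hε
  have hev : ∀ᶠ i in u, ∀ x ∈ K, dist (f i x) (g x) < δ :=
    (Finset.eventually_all K).2 fun x _ => Metric.tendsto_nhds.1 (h x) δ hδ
  filter_upwards [hM, hev] with i hi hi'
  rw [dist_eq_norm, ← map_sub]
  refine hK _ ((norm_sub_le _ _).trans (by gcongr; exact hi.trans (le_abs_self M))) fun x hx => ?_
  rw [sub_eq_add_neg, HL0.add_apply, HL0.neg_apply, ← sub_eq_add_neg, ← dist_eq_norm]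
  exact (hi' x hx).le

/-- The functionals whose restriction to the dual lies in the canonical image of `X` form a closed
subspace containing every `δ(x)`, hence all of `G0 X`. -/
theorem exists_point_of_mem_G0 [CompleteSpace X] {φ : StrongDual ℂ (HL0 X)} (hφ : φ ∈ G0 X) :
    ∃ x₀ : X, ∀ l : StrongDual ℂ X, φ (HL0.ofDual l) = l x₀ := by
  let J := NormedSpace.inclusionInDoubleDualLi ℂ (E := X)
  let res : StrongDual ℂ (HL0 X) →L[ℂ] StrongDual ℂ (StrongDual ℂ X) :=
    (ContinuousLinearMap.compL ℂ (StrongDual ℂ X) (HL0 X) ℂ).flip HL0.ofDual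
  have hcl : IsClosed (J.toLinearMap.range.comap res.toLinearMap :
      Set (StrongDual ℂ (HL0 X))) := by
    have hJ : IsClosed (Set.range J) := J.isometry.isUniformInducing.isComplete_range.isClosed
    exact hJ.preimage res.continuous
  have hle : G0 X ≤ J.toLinearMap.range.comap res.toLinearMap := by
    refine Submodule.topologicalClosure_minimal _ (Submodule.span_le.2 ?_) hcl
    rintro _ ⟨x, rfl⟩
    exact ⟨x, rfl⟩
  obtain ⟨x₀, hx₀⟩ := hle hφ
  exact ⟨x₀, fun l => (DFunLike.congr_fun hx₀ l).symm⟩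

theorem norm_sub_pow_le {a b : ℂ} (ha : ‖a‖ ≤ 1) (hb : ‖b‖ ≤ 1) (n : ℕ) :
    ‖a ^ n - b ^ n‖ ≤ n * ‖a - b‖ := by
  induction n with
  | zero => simp
  | succ n ih =>
    have e : a ^ (n + 1) - b ^ (n + 1) = a ^ n * (a - b) + (a ^ n - b ^ n) * b := by ring
    rw [e]
    refine (norm_add_le _ _).trans ?_
    rw [norm_mul, norm_mul, norm_pow]
    have h1 : ‖a‖ ^ n * ‖a - b‖ ≤ 1 * ‖a - b‖ := by
      gcongr
      exact pow_le_one₀ (norm_nonneg a) ha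
    have h2 : ‖a ^ n - b ^ n‖ * ‖b‖ ≤ n * ‖a - b‖ * 1 := by gcongr
    push_cast
    linarith

/-- For a norming functional `l`, the power `l ^ n` has Lipschitz constant at most `n` on the ball,
so `‖x₀‖ ^ n ≤ ‖φ‖ n`, impossible for large `n` if `‖x₀‖ > 1`. -/
theorem norm_point_le_one {φ : StrongDual ℂ (HL0 X)} (hmul : IsMultiplicative φ) {x₀ : X}
    (hx₀ : ∀ l : StrongDual ℂ X, φ (HL0.ofDual l) = l x₀) : ‖x₀‖ ≤ 1 := by
  obtain ⟨l, hl, hlx⟩ := exists_dual_vector'' ℂ x₀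
  have hlu : ∀ x : UBall X, ‖l x‖ ≤ 1 := fun x =>
    (l.le_opNorm x).trans (mul_le_one₀ hl (norm_nonneg _) (mem_ball_zero_iff.1 x.2).le)
  -- Exponents start at 1 because `l ^ 0` does not vanish at the origin.
  have hpow : ∀ n : ℕ, ‖x₀‖ ^ (n + 1) ≤ ‖φ‖ * (n + 1 : ℕ) := by
    intro n
    obtain ⟨f, hf, hfφ⟩ := ((HasValueAt.ofDual φ l).pow hmul (n + 1)).exists_of_map_origin
      (by simp [UBall.origin])
    have hfn : ‖f‖ ≤ (n + 1 : ℕ) := HL0.norm_le_of_lipschitzOn (by positivity) fun x y => by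
      rw [hf, hf]
      refine (norm_sub_pow_le (hlu x) (hlu y) (n + 1)).trans ?_
      gcongr
      rw [← map_sub]
      exact (l.le_opNorm _).trans (mul_le_of_le_one_left (norm_nonneg _) hl)
    have h := (φ.le_opNorm f).trans (mul_le_mul_of_nonneg_left hfn (norm_nonneg φ))
    rw [hfφ, hx₀, hlx] at h
    simpa using h
  by_contra! hlt
  have hlim := ((tendsto_pow_const_div_const_pow_of_one_lt 1 hlt).comp
    (tendsto_add_atTop_nat 1)).const_mul ‖φ‖
  rw [mul_zero] at hlim
  obtain ⟨n, hn⟩ := (hlim.eventually (gt_mem_nhds one_pos)).exists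
  have hp : 0 < ‖x₀‖ ^ (n + 1) := pow_pos (one_pos.trans hlt) _
  have h1 : ‖φ‖ * (n + 1 : ℕ) < ‖x₀‖ ^ (n + 1) := by
    simp only [Function.comp_apply, pow_one] at hn
    rwa [← mul_div_assoc, div_lt_one hp] at hn
  exact absurd (hpow n) h1.not_ge

/-- A multiplicative functional on a function of polynomial type composed with a finite-rank
operator. -/
theorem HasValueAt.comp_finiteRank {φ : StrongDual ℂ (HL0 X)} (hmul : IsMultiplicative φ) {x₀ : X}
    (hx₀ : ∀ l : StrongDual ℂ X, φ (HL0.ofDual l) = l x₀) {P : X → ℂ} (hP : Differentiable ℂ P)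
    {A : ℝ} {n : ℕ} (hA : ∀ v, ‖P v‖ ≤ A * (1 + ‖v‖) ^ n) (T : X →L[ℂ] X)
    [FiniteDimensional ℂ T.range] : HasValueAt φ (fun x => P (T x)) (P (T x₀)) := by
  let b := Module.finBasis ℂ T.range
  let l : Fin (Module.finrank ℂ T.range) → StrongDual ℂ X := fun i =>
    (b.coord i).toContinuousLinearMap ∘L T.rangeRestrict
  -- The leading `0` is the base point `v` of `HasValueAt.comp_sum_smul`.
  have hT : ∀ x, T x = 0 + ∑ i, l i x • (b i : X) := fun x => by
    have h := congrArg Subtype.val (b.sum_repr (T.rangeRestrict x))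
    have h' : T x = ∑ i, b.repr (T.rangeRestrict x) i • (b i : X) := by simpa using h.symm
    rw [zero_add]
    exact h'
  have h := HasValueAt.comp_sum_smul hmul hP hA Finset.univ (fun i => (b i : X))
    (fun i => HasValueAt.ofDual φ (l i)) 0
  simp only [hx₀] at h
  simpa only [hT] using h

end PreservesLimits

/-! ### From finite rank to Taylor terms and dilations -/

noncomputable section MultiplicativeInG0

variable {X : Type*} [NormedAddCommGroup X] [NormedSpace ℂ X]

/-- A multiplicative functional in `G0 X` evaluates every entire function of polynomial growth that
is Lipschitz on bounded sets. -/
theorem apply_eq_of_growth (hX : HasBAP X) {φ : StrongDual ℂ (HL0 X)} (hφ : φ ∈ G0 X)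
    (hmul : IsMultiplicative φ) {x₀ : X} (hx₀ : ∀ l : StrongDual ℂ X, φ (HL0.ofDual l) = l x₀)
    {P : X → ℂ} (hP : Differentiable ℂ P) (h0 : P 0 = 0) {A : ℝ} {n : ℕ}
    (hA : ∀ v, ‖P v‖ ≤ A * (1 + ‖v‖) ^ n)
    (hL : ∀ r : ℝ, ∃ C : ℝ≥0, LipschitzOnWith C P (closedBall 0 r))
    {p : HL0 X} (hp : ∀ x : UBall X, p x = P x) : φ p = P x₀ := by
  classical
  obtain ⟨lam, hlam, hT⟩ := hX
  obtain ⟨C, hC⟩ := hL lam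
  refine eq_of_forall_dist_le fun ε hε => ?_
  -- `C * lam` bounds the norm of `P ∘ T` for every admissible `T`. This uniformity allows `K` to be
  -- fixed before `T`, which depends on it.
  obtain ⟨K, δ, hδ, hK⟩ := exists_finset_of_mem_G0 hφ (M := ‖p‖ + C * lam) (by positivity)
    (half_pos hε)
  have hcont : ∀ x : X, ∃ η > 0, ∀ y, dist y x < η → dist (P y) (P x) < min δ (ε / 2) := fun x =>
    Metric.continuous_iff.1 hP.continuous x _ (lt_min hδ (half_pos hε))
  choose η hη hη' using hcont
  -- Closeness on `K` controls `φ (p - P ∘ T)`; closeness at `x₀` compares `P (T x₀)` with `P x₀`.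
  let S : Finset X := insert x₀ (K.image (↑))
  have hS : S.Nonempty := ⟨x₀, Finset.mem_insert_self _ _⟩
  obtain ⟨T, hfin, hTn, hTx⟩ := hT S S.finite_toSet.isCompact (S.inf' hS η)
    ((Finset.lt_inf'_iff hS).2 fun x _ => hη x)
  have hclose : ∀ x ∈ S, dist (P (T x)) (P x) < min δ (ε / 2) := fun x hx =>
    hη' x _ (by rw [dist_eq_norm]; exact (hTx x hx).trans_le (Finset.inf'_le η hx))
  obtain ⟨q, hq, hqφ⟩ := (HasValueAt.comp_finiteRank hmul hx₀ hP hA T).exists_of_map_origin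
    (by simp [UBall.origin, h0])
  have hmem : ∀ x : UBall X, T x ∈ closedBall (0 : X) lam := fun x => by
    rw [mem_closedBall_zero_iff]
    exact (T.le_opNorm x).trans ((mul_le_of_le_one_right (norm_nonneg T)
      (mem_ball_zero_iff.1 x.2).le).trans hTn)
  have hqn : ‖q‖ ≤ C * lam := HL0.norm_le_of_lipschitzOn (by positivity) fun x y => by
    have h := hC.dist_le_mul _ (hmem x) _ (hmem y)
    rw [dist_eq_norm, dist_eq_norm, ← map_sub] at h
    rw [hq, hq, mul_assoc]
    exact h.trans (by gcongr; exact (T.le_opNorm _).trans (by gcongr))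
  have h1 : ‖φ (p - q)‖ < ε / 2 := by
    refine hK _ ((norm_sub_le _ _).trans (by gcongr)) fun x hx => ?_
    rw [sub_eq_add_neg, HL0.add_apply, HL0.neg_apply, ← sub_eq_add_neg, ← dist_eq_norm, hp, hq,
      dist_comm]
    exact (lt_min_iff.1 (hclose x
      (Finset.mem_insert_of_mem (Finset.mem_image_of_mem _ hx)))).1.le
  have h2 := (lt_min_iff.1 (hclose x₀ (Finset.mem_insert_self _ _))).2
  rw [map_sub, hqφ, ← dist_eq_norm] at h1
  linarith [dist_triangle (φ p) (P (T x₀)) (P x₀)]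

theorem lipschitzOnWith_taylorTerm {F : X → ℂ} (hF : DifferentiableOn ℂ F (ball 0 1)) {C : ℝ≥0}
    (hC : LipschitzOnWith C F (ball 0 1)) (n : ℕ) {ρ : ℝ≥0} (hρ : 0 < ρ) {s : Set X}
    (hs : ∀ x ∈ s, ρ * ‖x‖ < 1) : LipschitzOnWith (C * ρ / ρ ^ n) (taylorTerm F n) s := by
  refine LipschitzOnWith.of_dist_le_mul fun x hx y hy => ?_
  rw [dist_eq_norm, dist_eq_norm]
  refine (norm_taylorTerm_sub_le hF hC n (NNReal.coe_pos.2 hρ) (hs x hx) (hs y hy)).trans_eq ?_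
  push_cast
  ring

namespace HL0

/-- The `n`-th term of the Taylor series of `f` at the origin. -/
def taylor (f : HL0 X) (n : ℕ) : HL0 X :=
  ofFun (taylorTerm f.extendZero n)
    (differentiable_taylorTerm f.differentiableOn_extendZero f.lipschitzOnWith_extendZero
      n).differentiableOn (‖f‖₊ * (1 / 2) / (1 / 2) ^ n)
    -- Any radius in `(0, 1)` would do in place of `1 / 2`.
    (lipschitzOnWith_taylorTerm f.differentiableOn_extendZero f.lipschitzOnWith_extendZero n
      (by norm_num) fun x hx => by
        rw [mem_ball_zero_iff] at hx
        push_cast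
        linarith)
    (taylorTerm_zero_right f.extendZero_zero n)

theorem taylor_apply (f : HL0 X) (n : ℕ) (x : UBall X) :
    f.taylor n x = taylorTerm f.extendZero n x := rfl

theorem norm_taylor_le (f : HL0 X) (n : ℕ) {ρ : ℝ} (hρ : 0 < ρ) (hρ1 : ρ < 1) :
    ‖f.taylor n‖ ≤ ‖f‖ * ρ / ρ ^ n := by
  refine norm_le_of_lipschitzOn (by positivity) fun x y => ?_
  have h : ∀ x : UBall X, ρ * ‖(x : X)‖ < 1 := fun x =>
    mul_lt_one_of_nonneg_of_lt_one_left hρ.le hρ1 (mem_ball_zero_iff.1 x.2).le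
  refine (norm_taylorTerm_sub_le f.differentiableOn_extendZero f.lipschitzOnWith_extendZero n hρ
    (h x) (h y)).trans_eq ?_
  push_cast
  ring

/-- The dilation `x ↦ f (r x)`. -/
def dilate (f : HL0 X) (r : ℂ) (hr : ‖r‖ ≤ 1) : HL0 X :=
  ofFun (fun x => f.extendZero (r • x))
    (f.differentiableOn_extendZero.comp (by fun_prop) fun x hx => by
      rw [mem_ball_zero_iff] at hx ⊢
      rw [norm_smul]
      exact (mul_le_of_le_one_left (norm_nonneg x) hr).trans_lt hx) ‖f‖₊
    (LipschitzOnWith.of_dist_le_mul fun x hx y hy => by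
      have h : ∀ z ∈ ball (0 : X) 1, r • z ∈ ball (0 : X) 1 := fun z hz => by
        rw [mem_ball_zero_iff] at hz ⊢
        rw [norm_smul]
        exact (mul_le_of_le_one_left (norm_nonneg z) hr).trans_lt hz
      refine (f.lipschitzOnWith_extendZero.dist_le_mul _ (h x hx) _ (h y hy)).trans ?_
      rw [dist_smul₀]
      gcongr
      exact mul_le_of_le_one_left dist_nonneg hr)
    (by rw [smul_zero, f.extendZero_zero])

theorem norm_dilate_le (f : HL0 X) (r : ℂ) (hr : ‖r‖ ≤ 1) : ‖f.dilate r hr‖ ≤ ‖f‖ :=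
  norm_le_of_lipschitzOn (norm_nonneg f) fun x y => by
    have h : ∀ z : UBall X, r • (z : X) ∈ ball (0 : X) 1 := fun z => by
      rw [mem_ball_zero_iff, norm_smul]
      exact (mul_le_of_le_one_left (norm_nonneg _) hr).trans_lt (mem_ball_zero_iff.1 z.2)
    have := f.lipschitzOnWith_extendZero.dist_le_mul _ (h x) _ (h y)
    rw [dist_smul₀, dist_eq_norm, dist_eq_norm] at this
    refine this.trans ?_
    gcongr
    · rfl
    · exact mul_le_of_le_one_left (norm_nonneg _) hr

end HL0

theorem apply_taylor (hX : HasBAP X) {φ : StrongDual ℂ (HL0 X)} (hφ : φ ∈ G0 X)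
    (hmul : IsMultiplicative φ) {x₀ : X} (hx₀ : ∀ l : StrongDual ℂ X, φ (HL0.ofDual l) = l x₀)
    (f : HL0 X) (n : ℕ) : φ (f.taylor n) = taylorTerm f.extendZero n x₀ := by
  have hF := f.differentiableOn_extendZero
  have hC := f.lipschitzOnWith_extendZero
  refine apply_eq_of_growth hX hφ hmul hx₀ (differentiable_taylorTerm hF hC n)
    (taylorTerm_zero_right f.extendZero_zero n) (A := ‖f‖₊) (n := n) (fun v => ?_) (fun r => ?_)
    (f.taylor_apply n)
  · rw [add_comm]
    exact norm_taylorTerm_le hF hC f.extendZero_zero n v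
  · obtain ⟨ρ, hρ, h⟩ := exists_radius (E := X) r
    lift ρ to ℝ≥0 using hρ.le
    exact ⟨_, lipschitzOnWith_taylorTerm hF hC n hρ fun x hx => h x (mem_closedBall_zero_iff.1 hx)⟩

/-- With `|r| < ρ < 1` the series `∑ rⁿ • f.taylor n` converges absolutely, so its partial sums are
bounded in norm and converge pointwise to the dilation. -/
theorem apply_dilate (hX : HasBAP X) {φ : StrongDual ℂ (HL0 X)} (hφ : φ ∈ G0 X)
    (hmul : IsMultiplicative φ) {x₀ : X} (hx₀ : ∀ l : StrongDual ℂ X, φ (HL0.ofDual l) = l x₀)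
    (hx₀1 : ‖x₀‖ ≤ 1) (f : HL0 X) {r : ℂ} (hr : ‖r‖ < 1) :
    φ (f.dilate r hr.le) = f.extendZero (r • x₀) := by
  have hF := f.differentiableOn_extendZero
  obtain ⟨ρ, hrρ, hρ1⟩ := exists_between hr
  have hρ : 0 < ρ := (norm_nonneg r).trans_lt hrρ
  have hsum : Summable fun n => ‖r‖ ^ n * ‖f.taylor n‖ := by
    have hg : Summable fun n => ‖f‖ * ρ * (‖r‖ / ρ) ^ n :=
      (summable_geometric_of_lt_one (by positivity) ((div_lt_one hρ).2 hrρ)).mul_left _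
    refine hg.of_nonneg_of_le (fun n => by positivity) fun n => ?_
    refine (mul_le_mul_of_nonneg_left (f.norm_taylor_le n hρ hρ1) (by positivity)).trans_eq ?_
    rw [div_pow]
    ring
  have happly : ∀ (s : Finset ℕ) (x : UBall X), (∑ n ∈ s, r ^ n • f.taylor n) x =
      ∑ n ∈ s, r ^ n * taylorTerm f.extendZero n x := fun s x => by
    change HL0.delta X x _ = _
    rw [map_sum]
    exact Finset.sum_congr rfl fun n _ => by rw [map_smul]; rfl
  have h1 : Tendsto (fun s : Finset ℕ => φ (∑ n ∈ s, r ^ n • f.taylor n)) atTop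
      (𝓝 (φ (f.dilate r hr.le))) := by
    refine tendsto_apply_of_mem_G0 hφ (M := ∑' n, ‖r‖ ^ n * ‖f.taylor n‖)
      (Eventually.of_forall fun s => ?_) fun x => ?_
    · refine (norm_sum_le _ _).trans ((Finset.sum_le_sum fun n _ => ?_).trans
        (hsum.sum_le_tsum s fun n _ => by positivity))
      rw [norm_smul, norm_pow]
    · simp only [happly]
      exact hasSum_taylorTerm hF (mem_ball_zero_iff.1 x.2).le hr
  have h2 : HasSum (fun n => r ^ n * taylorTerm f.extendZero n x₀) (φ (f.dilate r hr.le)) := by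
    refine h1.congr fun s => ?_
    rw [map_sum]
    exact Finset.sum_congr rfl fun n _ => by
      rw [map_smul, apply_taylor hX hφ hmul hx₀, smul_eq_mul]
  exact h2.unique (hasSum_taylorTerm hF hx₀1 hr)

end MultiplicativeInG0

theorem proposition3p9 (X : Type*) [NormedAddCommGroup X] [NormedSpace ℂ X] [CompleteSpace X]
    (hX : HasBAP X) (φ : StrongDual ℂ (HL0 X)) (hφ : φ ∈ G0 X) (hmul : IsMultiplicative φ) :
    ∃ x₀ : ↥(Metric.closedBall (0 : X) 1), φ = HL0.deltaBar X x₀ := by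
  obtain ⟨x₀, hx₀⟩ := exists_point_of_mem_G0 hφ
  have hx₀1 := norm_point_le_one hmul hx₀
  refine ⟨⟨x₀, mem_closedBall_zero_iff.2 hx₀1⟩, ContinuousLinearMap.ext fun f => ?_⟩
  let r : ℕ → ℂ := fun n => ((n / (n + 1) : ℝ) : ℂ)
  have hr : ∀ n, ‖r n‖ < 1 := fun n => by
    rw [Complex.norm_real, Real.norm_of_nonneg (by positivity), div_lt_one (by positivity)]
    exact lt_add_one _
  have hr1 : Tendsto r atTop (𝓝 1) := by
    have h := (Complex.continuous_ofReal.tendsto 1).comp (tendsto_natCast_div_add_atTop (1 : ℝ))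
    rwa [Complex.ofReal_one] at h
  have hmem : ∀ n, ∀ x : X, ‖x‖ ≤ 1 → r n • x ∈ ball (0 : X) 1 := fun n x hx => by
    rw [mem_ball_zero_iff, norm_smul]
    exact mul_lt_one_of_nonneg_of_lt_one_left (norm_nonneg _) (hr n) hx
  have hlim : ∀ x : X, Tendsto (fun n => r n • x) atTop (𝓝 x) := fun x => by
    simpa using hr1.smul_const x
  have h1 : Tendsto (fun n => φ (f.dilate (r n) (hr n).le)) atTop (𝓝 (φ f)) := by
    refine tendsto_apply_of_mem_G0 hφ (M := ‖f‖)
      (Eventually.of_forall fun n => f.norm_dilate_le _ _) fun x => ?_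
    have hc : ContinuousAt f.extendZero x :=
      f.differentiableOn_extendZero.continuousOn.continuousAt (isOpen_ball.mem_nhds x.2)
    rw [← f.extendZero_coe x]
    exact hc.tendsto.comp (hlim x)
  -- The points `r n • x₀` approach `x₀` inside the open ball, even if `‖x₀‖ = 1`, and such limits
  -- define `extend`.
  have h2 : Tendsto (fun n => f ⟨r n • x₀, hmem n x₀ hx₀1⟩) atTop
      (𝓝 (f.extend ⟨x₀, mem_closedBall_zero_iff.2 hx₀1⟩)) :=
    (f.tendsto_extend _).comp (tendsto_comap_iff.2 (hlim x₀))
  refine tendsto_nhds_unique h1 (h2.congr fun n => ?_)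
  rw [apply_dilate hX hφ hmul hx₀ hx₀1 f (hr n), ← HL0.extendZero_coe]
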